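/- **Proposition 3.3 (Clusters as thinned marked branching processes).** Let $n\ge 1$, let $w=(w_j)_{j\in[n]}$ be non-negative weights on $[n]=\{1,\dots,n\}$, and let $\ell_n=\sum_{j\in[n]}w_j>0$. Let ${\rm NR}_n(w)$ be the random graph on $[n]$ in which the edges $ij$, $1\le i<j\le n$, are present independently of each other, with probability $1-e^{-w_iw_j/\ell_n}$. Let $V_n$ be uniformly distributed on $[n]$ and independent of the graph, and let $\mathcal C(V_n)$ be the set of all vertices joined to $V_n$ by a path of present edges (including $V_n$ itself). Let $(M_i,X_i)_{i\ge1}$ be independent pairs such that $M_1$ is uniformly distributed on $[n]$, $\mathbb P(M_i=m)=w_m/\ell_n$ for $m\in[n]$ and $i\ge2$, and, conditionally on $M_i$, $X_i$ has a Poisson distribution with mean $w_{M_i}$, for each $i\ge1$. Put $\widetilde X_1=X_1$ and $\widetilde X_i=X_i\mathbf 1_{\{M_i\notin\{M_1,\dots,M_{i-1}\}\}}$ for $i\ge2$; put $\widetilde S_0=1$ and $\widetilde S_i=\widetilde S_{i-1}+\widetilde X_i-1$ for $i\ge1$; and let $\widetilde T=\inf\{t\ge1:\widetilde S_t=0\}$.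 Then the random subset $\mathcal C(V_n)$ of $[n]$ has the same distribution as the random set $\{M_1,\dots,M_{\widetilde T}\}$. -/

import Mathlib

open MeasureTheory ProbabilityTheory
open scoped NNReal ENNReal

namespace NorrosReittu

variable {n : ℕ}

/-! The vertex set `[n]` is `Fin n`; the vertex weights are `w : Fin n → ℝ≥0`. -/

/-- The total weight `ℓ_n = ∑_j w_j`. -/
noncomputable def totalWeight (w : Fin n → ℝ≥0) : ℝ≥0 := ∑ j, w j

/-- The edge probability `p_{ij} = 1 - exp (- w_i w_j / ℓ_n)`, as a point of `[0, 1]`. -/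
noncomputable def edgeProb (w : Fin n → ℝ≥0) (i j : Fin n) : unitInterval :=
  ⟨1 - Real.exp (-((w i * w j / totalWeight w : ℝ≥0) : ℝ)),
    sub_nonneg.2 (Real.exp_le_one_iff.2 (neg_nonpos.2 (NNReal.coe_nonneg _))),
    sub_le_self _ (Real.exp_pos _).le⟩

/-- The possible edges, i.e. the pairs `i < j` of vertices. -/
abbrev EdgeSlot (n : ℕ) : Type := {e : Fin n × Fin n // e.1 < e.2}

/-- The graph whose edges are the pairs `i < j` that are occupied in `ω`. -/
def graphOfOccupied (ω : EdgeSlot n → Prop) : SimpleGraph (Fin n) :=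
  SimpleGraph.fromRel fun i j => ∃ h : i < j, ω ⟨(i, j), h⟩

/-- The law of the Norros-Reittu random graph `NR_n(w)`: the pairs `i < j` are occupied
independently of each other, the pair `ij` with probability `edgeProb w i j`. -/
noncomputable def graphLaw (w : Fin n → ℝ≥0) : Measure (SimpleGraph (Fin n)) :=
  (Measure.pi fun e : EdgeSlot n =>
    bernoulliMeasure True False (edgeProb w e.1.1 e.1.2)).map graphOfOccupied

/-- The cluster of `v`: all vertices that are joined to `v` by a path of edges (`v` included). -/
def cluster (G : SimpleGraph (Fin n)) (v : Fin n) : Set (Fin n) := {x | G.Reachable v x}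

/-- The mark distribution `P(M = m) = w_m / ℓ_n`, `m ∈ [n]`. -/
noncomputable def markLaw (w : Fin n → ℝ≥0) : Measure (Fin n) :=
  ∑ m, ((w m / totalWeight w : ℝ≥0) : ℝ≥0∞) • Measure.dirac m

/-- Given the mark `m` of an individual, its number of children is Poisson with mean `w m`. -/
noncomputable def offspringKernel (w : Fin n → ℝ≥0) : Kernel (Fin n) ℕ :=
  Kernel.ofFunOfCountable fun m => poissonMeasure (w m)

instance (w : Fin n → ℝ≥0) : IsMarkovKernel (offspringKernel w) :=
  ⟨fun m => inferInstanceAs (IsProbabilityMeasure (poissonMeasure (w m)))⟩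

/-- The joint law of the mark and the number of children of the individual with index `i` in
the order of exploration. Indices start at `0`: individual `0` is the root, whose mark is uniform
on `[n]`; the marks of all other individuals have law `markLaw w`. -/
noncomputable def individualLaw (w : Fin n → ℝ≥0) (i : ℕ) : Measure (Fin n × ℕ) :=
  (if i = 0 then uniformOn Set.univ else markLaw w) ⊗ₘ offspringKernel w

/-- The law of the sequence of (mark, number of children), independent over the individuals, of
the marked two-stage mixed Poisson branching process. -/
noncomputable def branchingLaw (w : Fin n → ℝ≥0) : Measure (ℕ → Fin n × ℕ) :=
  Measure.infinitePi (individualLaw w)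

open Classical in
/-- Thinning: an individual whose mark has occurred before gets no children. -/
noncomputable def thinned (m : ℕ → Fin n) (x : ℕ → ℕ) (i : ℕ) : ℕ :=
  if ∃ j < i, m j = m i then 0 else x i

/-- The exploration walk of the thinned process: it starts at `1`, and exploring the next
individual adds the thinned number of its children and subtracts one. -/
noncomputable def thinnedWalk (m : ℕ → Fin n) (x : ℕ → ℕ) : ℕ → ℤ
  | 0 => 1
  | i + 1 => thinnedWalk m x i + (thinned m x i : ℤ) - 1

/-- The end of the exploration: the first `t ≥ 1` at which the thinned walk is `0`
(`⊤` if there is no such `t`). -/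
noncomputable def explorationEnd (m : ℕ → Fin n) (x : ℕ → ℕ) : ℕ∞ :=
  ⨅ (t : ℕ) (_ : 1 ≤ t ∧ thinnedWalk m x t = 0), (t : ℕ∞)

/-- The set of the marks of the individuals explored up to the end of the exploration. As indices
start at `0`, these are the individuals with index less than `explorationEnd`. -/
noncomputable def exploredMarks (m : ℕ → Fin n) (x : ℕ → ℕ) : Set (Fin n) :=
  {a | ∃ i : ℕ, (i : ℕ∞) < explorationEnd m x ∧ m i = a}

end NorrosReittu

/-! Both sets arise from explorations that can be matched step by step. In a state `(D, k)`, `D` is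
the set of marks found and `k` the number of individuals waiting. The core is
`finalExpectation_eq_addMark_iterate`: for every test function, the thinned branching process run
from `(D, k)` has the same expectation as the graph exploration, along edges outside `D`, started
from `k` independent marks.

Two facts drive it. A repeated mark has no effect: thinning denies it children, and the graph
exploration ignores starting vertices in `D`. For a new mark `m`, the edges at `m` are independent
of those used later (`exploredExpectation_insert_of_notMem`), and by Poisson splitting the marks of
a Poisson(`w m`) number of individuals, together with `m`, are distributed as the neighbours of `m`,
together with `m` (`lintegral_addMark_iterate_poissonMeasure`): each `j ≠ m` is missed independently
with probability `exp (-w m * w j / ℓ_n)`. Every step enlarges `D` or keeps `D` and lowers `k`, so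
induction applies and needs no separate termination argument. -/

namespace NorrosReittu

variable {n : ℕ}

/-! ### The thinned exploration as a recursion on states -/

open Classical in
/-- One step of the exploration. The state consists of the set of marks found so far and the
number of individuals waiting to be explored; the exploration stops when nobody is waiting. -/
noncomputable def exploreStep (s : Set (Fin n) × ℕ) (p : Fin n × ℕ) : Set (Fin n) × ℕ :=
  if s.2 = 0 then s else (insert p.1 s.1, s.2 - 1 + if p.1 ∈ s.1 then 0 else p.2)

/-- The state of the exploration after `t` steps, started from the state `s`. -/
noncomputable def exploreState (s : Set (Fin n) × ℕ) (y : ℕ → Fin n × ℕ) : ℕ → Set (Fin n) × ℕ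
  | 0 => s
  | t + 1 => exploreStep (exploreState s y t) (y t)

/-- The set of all marks found by the exploration started from the state `s`. -/
noncomputable def finalMarks (s : Set (Fin n) × ℕ) (y : ℕ → Fin n × ℕ) : Set (Fin n) :=
  ⋃ t, (exploreState s y t).1

lemma exploreState_succ' (s : Set (Fin n) × ℕ) (y : ℕ → Fin n × ℕ) (t : ℕ) :
    exploreState s y (t + 1) = exploreState (exploreStep s (y 0)) (fun i => y (i + 1)) t := by
  induction t with
  | zero => rfl
  | succ t ih => rw [exploreState, ih]; rfl

lemma exploreStep_of_eq_zero {s : Set (Fin n) × ℕ} (hs : s.2 = 0) (p : Fin n × ℕ) :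
    exploreStep s p = s := if_pos hs

lemma subset_exploreStep (s : Set (Fin n) × ℕ) (p : Fin n × ℕ) : s.1 ⊆ (exploreStep s p).1 := by
  by_cases hs : s.2 = 0
  · rw [exploreStep_of_eq_zero hs]
  · rw [exploreStep, if_neg hs]
    exact Set.subset_insert _ _

lemma finalMarks_eq_finalMarks_exploreStep (s : Set (Fin n) × ℕ) (y : ℕ → Fin n × ℕ) :
    finalMarks s y = finalMarks (exploreStep s (y 0)) (fun i => y (i + 1)) := by
  unfold finalMarks
  simp_rw [← exploreState_succ']
  refine subset_antisymm (Set.iUnion_subset fun t => ?_)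
    (Set.iUnion_subset fun t => Set.subset_iUnion (fun t => (exploreState s y t).1) (t + 1))
  exact (subset_exploreStep _ _).trans
    (Set.subset_iUnion (fun t => (exploreState s y (t + 1)).1) t)

lemma finalMarks_zero (D : Set (Fin n)) (y : ℕ → Fin n × ℕ) : finalMarks (D, 0) y = D := by
  have h : ∀ t, exploreState (D, 0) y t = (D, 0) := fun t => by
    induction t with
    | zero => rfl
    | succ t ih => rw [exploreState, ih, exploreStep_of_eq_zero rfl]
  simp [finalMarks, h, Set.iUnion_const]

lemma exploreState_snd_eq_zero_of_le {s : Set (Fin n) × ℕ} {y : ℕ → Fin n × ℕ} {t u : ℕ}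
    (htu : t ≤ u) (ht : (exploreState s y t).2 = 0) : (exploreState s y u).2 = 0 := by
  induction u, htu using Nat.le_induction with
  | base => exact ht
  | succ u _ ih => rw [exploreState, exploreStep_of_eq_zero ih, ih]

/-- Before the end of the exploration, the state consists of the marks explored so far and the
value of the thinned walk. -/
lemma exploreState_eq_thinnedWalk (m : ℕ → Fin n) (x : ℕ → ℕ) (t : ℕ)
    (ht : ∀ s < t, (exploreState (∅, 1) (fun i => (m i, x i)) s).2 ≠ 0) :
    (exploreState (∅, 1) (fun i => (m i, x i)) t).1 = {a | ∃ i < t, m i = a} ∧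
      ((exploreState (∅, 1) (fun i => (m i, x i)) t).2 : ℤ) = thinnedWalk m x t := by
  induction t with
  | zero => simp [exploreState, thinnedWalk]
  | succ t ih =>
    obtain ⟨h1, h2⟩ := ih fun s hs => ht s (by lia)
    have h3 := ht t (by lia)
    rw [exploreState, exploreStep, if_neg h3]
    constructor
    · rw [h1]
      ext a
      simp only [Set.mem_insert_iff, Set.mem_ofPred_eq, Order.lt_add_one_iff]
      constructor
      · rintro (rfl | ⟨i, hi, rfl⟩)
        exacts [⟨t, le_rfl, rfl⟩, ⟨i, hi.le, rfl⟩]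
      · rintro ⟨i, hi, rfl⟩
        rcases hi.eq_or_lt with rfl | hi
        exacts [Or.inl rfl, Or.inr ⟨i, hi, rfl⟩]
    · rw [thinnedWalk, ← h2, thinned, h1]
      simp only [Set.mem_ofPred_eq]
      -- The truncated subtraction `s.2 - 1` is exact here, because somebody is waiting.
      push_cast [Nat.one_le_iff_ne_zero.2 h3]
      split_ifs <;> lia

lemma lt_explorationEnd_iff {m : ℕ → Fin n} {x : ℕ → ℕ} {i : ℕ} :
    (i : ℕ∞) < explorationEnd m x ↔ ∀ t, 1 ≤ t → t ≤ i → thinnedWalk m x t ≠ 0 := by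
  constructor
  · intro h t h1 hti h0
    refine absurd h (not_lt.2 ?_)
    exact (iInf₂_le (f := fun (t : ℕ) (_ : 1 ≤ t ∧ thinnedWalk m x t = 0) => (t : ℕ∞)) t
      ⟨h1, h0⟩).trans (by exact_mod_cast hti)
  · intro h
    have : ((i + 1 : ℕ) : ℕ∞) ≤ explorationEnd m x := by
      refine le_iInf₂ fun t ht => ?_
      by_contra hlt
      have : t < i + 1 := by exact_mod_cast not_le.1 hlt
      exact h t ht.1 (by lia) ht.2
    exact lt_of_lt_of_le (by exact_mod_cast Nat.lt_succ_self i) this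

/-- The walk moves on after reaching zero while the state freezes there, but they agree up to their
common first zero, which is all that matters. -/
lemma lt_explorationEnd_iff_exploreState {m : ℕ → Fin n} {x : ℕ → ℕ} {i : ℕ} :
    (i : ℕ∞) < explorationEnd m x ↔
      (exploreState (∅, 1) (fun i => (m i, x i)) i).2 ≠ 0 := by
  rw [lt_explorationEnd_iff]
  constructor
  · intro h
    have : ∀ s ≤ i, (exploreState (∅, 1) (fun i => (m i, x i)) s).2 ≠ 0 := by
      intro s
      induction s using Nat.strong_induction_on with
      | _ s ih =>
        intro hs h0
        have := (exploreState_eq_thinnedWalk m x s fun r hr => ih r hr (by lia)).2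
        rcases Nat.eq_zero_or_pos s with rfl | hpos
        · simp [exploreState] at h0
        · exact h s hpos hs (by rw [← this, h0]; rfl)
    exact this i le_rfl
  · intro h t _ hti h0
    have hne : ∀ s ≤ i, (exploreState (∅, 1) (fun i => (m i, x i)) s).2 ≠ 0 :=
      fun s hs hs0 => h (exploreState_snd_eq_zero_of_le hs hs0)
    have := (exploreState_eq_thinnedWalk m x t fun r hr => hne r (by lia)).2
    rw [h0] at this
    exact hne t hti (by exact_mod_cast this)

/-- Freezing at zero replaces the stopping time by a union over all steps, which satisfies a
one-step recursion. -/
lemma exploredMarks_eq_finalMarks (m : ℕ → Fin n) (x : ℕ → ℕ) :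
    exploredMarks m x = finalMarks (∅, 1) (fun i => (m i, x i)) := by
  apply subset_antisymm
  · rintro a ⟨i, hi, rfl⟩
    rw [lt_explorationEnd_iff_exploreState] at hi
    refine Set.mem_iUnion.2 ⟨i + 1, ?_⟩
    rw [exploreState, exploreStep, if_neg hi]
    exact Set.mem_insert _ _
  · refine Set.iUnion_subset fun t => ?_
    induction t with
    | zero => exact Set.empty_subset _
    | succ t ih =>
      rw [exploreState]
      by_cases h : (exploreState (∅, 1) (fun i => (m i, x i)) t).2 = 0
      · rwa [exploreStep_of_eq_zero h]
      · rw [exploreStep, if_neg h]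
        exact Set.insert_subset ⟨t, lt_explorationEnd_iff_exploreState.2 h, rfl⟩ ih

lemma measurable_exploreState (s : Set (Fin n) × ℕ) (t : ℕ) :
    Measurable fun y : ℕ → Fin n × ℕ => exploreState s y t := by
  induction t with
  | zero => exact measurable_const
  | succ t ih =>
    have h : Measurable fun q : (Set (Fin n) × ℕ) × (Fin n × ℕ) => exploreStep q.1 q.2 :=
      Measurable.of_discrete
    exact h.comp (ih.prodMk (measurable_pi_apply t))

lemma measurable_finalMarks (s : Set (Fin n) × ℕ) : Measurable (finalMarks s) := by
  refine measurable_set_iff.2 fun a => ?_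
  simp only [finalMarks, Set.mem_iUnion]
  refine Measurable.exists fun t => ?_
  have h : Measurable fun q : Set (Fin n) × ℕ => a ∈ q.1 := Measurable.of_discrete
  exact h.comp (measurable_exploreState s t)

/-! ### First-step decomposition of the branching law -/

/-- Prepend a first term to a sequence. -/
def consSeq {α : Type*} (p : α × (ℕ → α)) : ℕ → α
  | 0 => p.1
  | i + 1 => p.2 i

lemma measurable_consSeq {α : Type*} [MeasurableSpace α] :
    Measurable (consSeq : α × (ℕ → α) → ℕ → α) := by
  refine measurable_pi_iff.2 fun i => ?_
  cases i with
  | zero => exact measurable_fst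
  | succ i => exact (measurable_pi_apply i).comp measurable_snd

lemma infinitePi_eq_map_consSeq {α : Type*} [MeasurableSpace α] (μ : ℕ → Measure α)
    [∀ i, IsProbabilityMeasure (μ i)] :
    Measure.infinitePi μ =
      ((μ 0).prod (Measure.infinitePi fun i => μ (i + 1))).map consSeq := by
  classical
  refine (Measure.eq_infinitePi μ fun s t ht => ?_).symm
  obtain ⟨N, hN⟩ : ∃ N, s ⊆ Finset.range (N + 1) :=
    ⟨s.sup id, fun i hi => Finset.mem_range.2 (Nat.lt_succ_of_le (Finset.le_sup (f := id) hi))⟩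
  -- Padding with `Set.univ` turns the cylinder over `s` into one over an initial segment, from
  -- which coordinate `0` splits off.
  let u : ℕ → Set α := fun i => if i ∈ s then t i else Set.univ
  have hu : ∀ i, MeasurableSet (u i) := fun i => by
    by_cases hi : i ∈ s
    · simpa [u, hi] using ht i
    · simp [u, hi]
  have hset : consSeq ⁻¹' ((s : Set ℕ).pi t) =
      u 0 ×ˢ ((Finset.range N : Set ℕ).pi fun i => u (i + 1)) := by
    ext p
    simp only [Set.mem_preimage, Set.mem_pi, Finset.mem_coe, Set.mem_prod, Finset.mem_range]
    constructor
    · intro h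
      have h' : ∀ i, consSeq p i ∈ u i := fun i => by
        by_cases hi : i ∈ s
        · simpa [u, hi] using h i hi
        · simp [u, hi]
      exact ⟨h' 0, fun i _ => h' (i + 1)⟩
    · rintro ⟨h0, h1⟩ i hi
      have : consSeq p i ∈ u i := by
        cases i with
        | zero => exact h0
        | succ i => exact h1 i (by simpa using hN hi)
      simpa [u, hi] using this
  rw [Measure.map_apply measurable_consSeq (MeasurableSet.pi s.countable_toSet fun i _ => ht i),
    hset, Measure.prod_prod, Measure.infinitePi_pi _ fun i _ => hu (i + 1), mul_comm,
    ← Finset.prod_range_succ' (fun i => μ i (u i)), ← Finset.prod_subset hN]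
  · refine Finset.prod_congr rfl fun i hi => by simp [u, hi]
  · intro i _ hi
    simp [u, hi]

lemma lintegral_infinitePi_eq_lintegral_consSeq {α : Type*} [MeasurableSpace α]
    (μ : ℕ → Measure α) [∀ i, IsProbabilityMeasure (μ i)] {f : (ℕ → α) → ℝ≥0∞}
    (hf : Measurable f) :
    ∫⁻ y, f y ∂Measure.infinitePi μ =
      ∫⁻ p, ∫⁻ y, f (consSeq (p, y)) ∂(Measure.infinitePi fun i => μ (i + 1)) ∂μ 0 := by
  rw [infinitePi_eq_map_consSeq, lintegral_map hf measurable_consSeq]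
  exact lintegral_prod (fun p => f (consSeq p)) (hf.comp measurable_consSeq).aemeasurable

lemma isProbabilityMeasure_markLaw {w : Fin n → ℝ≥0} (hw : 0 < totalWeight w) :
    IsProbabilityMeasure (markLaw w) := by
  constructor
  simp only [markLaw, Measure.coe_finsetSum, Finset.sum_apply, Measure.smul_apply, measure_univ,
    smul_eq_mul, mul_one]
  rw [← ENNReal.ofNNReal_finsetSum, ← Finset.sum_div, ← totalWeight, div_self hw.ne', ENNReal.coe_one]

/-- The law of the sequence of (mark, number of children) of the individuals other than the
root. -/
noncomputable def descendantLaw (w : Fin n → ℝ≥0) : Measure (ℕ → Fin n × ℕ) :=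
  Measure.infinitePi fun _ => markLaw w ⊗ₘ offspringKernel w

/-- The expectation of `φ` of the final set of marks of the exploration started from `s`. -/
noncomputable def finalExpectation (w : Fin n → ℝ≥0) (φ : Set (Fin n) → ℝ≥0∞)
    (s : Set (Fin n) × ℕ) : ℝ≥0∞ :=
  ∫⁻ y, φ (finalMarks s y) ∂descendantLaw w

section

variable {w : Fin n → ℝ≥0}

lemma offspringKernel_apply (m : Fin n) : offspringKernel w m = poissonMeasure (w m) := rfl

lemma finalMarks_consSeq (s : Set (Fin n) × ℕ) (p : Fin n × ℕ) (y : ℕ → Fin n × ℕ) :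
    finalMarks s (consSeq (p, y)) = finalMarks (exploreStep s p) y :=
  finalMarks_eq_finalMarks_exploreStep s (consSeq (p, y))

variable [IsProbabilityMeasure (markLaw w)]

instance : IsProbabilityMeasure (descendantLaw w) := by
  unfold descendantLaw
  infer_instance

lemma finalExpectation_zero (φ : Set (Fin n) → ℝ≥0∞) (D : Set (Fin n)) :
    finalExpectation w φ (D, 0) = φ D := by
  simp [finalExpectation, finalMarks_zero]

/-- Descendants are identically distributed, so the shifted sequence has the law `descendantLaw w`
again. -/
lemma finalExpectation_eq_lintegral (φ : Set (Fin n) → ℝ≥0∞) (s : Set (Fin n) × ℕ) :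
    finalExpectation w φ s = ∫⁻ m, ∫⁻ x, finalExpectation w φ (exploreStep s (m, x))
      ∂poissonMeasure (w m) ∂markLaw w := by
  have hf : Measurable fun y => φ (finalMarks s y) :=
    (Measurable.of_discrete (f := φ)).comp (measurable_finalMarks s)
  rw [finalExpectation, descendantLaw, lintegral_infinitePi_eq_lintegral_consSeq _ hf,
    Measure.lintegral_compProd Measurable.of_discrete]
  simp only [finalMarks_consSeq]
  rfl

lemma lintegral_branchingLaw [Nonempty (Fin n)] (φ : Set (Fin n) → ℝ≥0∞) :
    ∫⁻ y, φ (finalMarks (∅, 1) y) ∂branchingLaw w =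
      ∫⁻ m, ∫⁻ x, finalExpectation w φ ({m}, x) ∂poissonMeasure (w m)
        ∂uniformOn Set.univ := by
  have : ∀ i, IsProbabilityMeasure (individualLaw w i) := fun i => by
    have : IsProbabilityMeasure (uniformOn (Set.univ : Set (Fin n))) :=
      isProbabilityMeasure_uniformOn Set.finite_univ Set.univ_nonempty
    unfold individualLaw
    split_ifs <;> infer_instance
  have hf : Measurable fun y : ℕ → Fin n × ℕ => φ (finalMarks (∅, 1) y) :=
    (Measurable.of_discrete (f := φ)).comp (measurable_finalMarks _)
  have hlaw : (fun i => individualLaw w (i + 1)) =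
      fun _ => markLaw w ⊗ₘ offspringKernel w := by
    funext i
    simp [individualLaw]
  have h0 : individualLaw w 0 = uniformOn Set.univ ⊗ₘ offspringKernel w := by
    simp [individualLaw]
  rw [branchingLaw, lintegral_infinitePi_eq_lintegral_consSeq _ hf, h0,
    Measure.lintegral_compProd Measurable.of_discrete]
  simp only [finalMarks_consSeq, hlaw, exploreStep, offspringKernel_apply]
  simp [finalExpectation, descendantLaw]

end

/-! ### Exploration of a fixed graph -/

/-- The vertices found by exploring the graph from `R`, when the vertices in `D` have been found
and explored already: the least set that contains `D` and `R` and is closed under following edges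
outside `D`. -/
def explored (G : SimpleGraph (Fin n)) (D R : Set (Fin n)) : Set (Fin n) :=
  ⋂₀ {S | D ∪ R ⊆ S ∧ ∀ a ∈ S, a ∉ D → ∀ b, b ∉ D → G.Adj a b → b ∈ S}

lemma explored_empty (G : SimpleGraph (Fin n)) (D : Set (Fin n)) : explored G D ∅ = D := by
  refine subset_antisymm (Set.sInter_subset_of_mem ⟨by simp, fun a ha h => absurd ha h⟩) ?_
  exact Set.subset_sInter fun S hS => Set.subset_union_left.trans hS.1

lemma explored_insert_of_mem (G : SimpleGraph (Fin n)) {D : Set (Fin n)} (R : Set (Fin n))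
    {m : Fin n} (hm : m ∈ D) : explored G D (insert m R) = explored G D R := by
  rw [explored, explored, Set.union_insert, Set.insert_eq_of_mem (Set.mem_union_left _ hm)]

/-- Exploring the vertex `m` means moving it to the set of explored vertices, and adding its
neighbours to the set of vertices to be explored. -/
lemma explored_insert_of_notMem (G : SimpleGraph (Fin n)) {D : Set (Fin n)} (R : Set (Fin n))
    {m : Fin n} (hm : m ∉ D) :
    explored G D (insert m R) = explored G (insert m D) (insert m R ∪ G.neighborSet m) := by
  unfold explored
  congr 1
  ext S
  constructor
  · rintro ⟨h1, h2⟩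
    have hmS : m ∈ S := h1 (Or.inr (Or.inl rfl))
    refine ⟨?_, fun a ha haD b hbD hab => h2 a ha (fun h => haD (Or.inr h)) b
      (fun h => hbD (Or.inr h)) hab⟩
    rintro x ((rfl | hx) | (hx | hx))
    · exact hmS
    · exact h1 (Or.inl hx)
    · exact h1 (Or.inr hx)
    · by_cases hxD : x ∈ D
      · exact h1 (Or.inl hxD)
      · exact h2 m hmS hm x hxD hx
  · rintro ⟨h1, h2⟩
    refine ⟨?_, fun a ha haD b hbD hab => ?_⟩
    · rintro x (hx | hx)
      · exact h1 (Or.inl (Or.inr hx))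
      · exact h1 (Or.inr (Or.inl hx))
    · by_cases hbm : b = m
      · exact hbm ▸ h1 (Or.inl (Or.inl rfl))
      · by_cases ham : a = m
        · exact h1 (Or.inr (Or.inr (ham ▸ hab)))
        · exact h2 a ha (by simp [ham, haD]) b (by simp [hbm, hbD]) hab

lemma explored_congr {G H : SimpleGraph (Fin n)} {D : Set (Fin n)} (R : Set (Fin n))
    (h : ∀ a ∉ D, ∀ b ∉ D, (G.Adj a b ↔ H.Adj a b)) : explored G D R = explored H D R := by
  unfold explored
  congr 1
  ext S
  refine and_congr_right fun _ => ⟨fun hS a ha haD b hbD hab => ?_,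
    fun hS a ha haD b hbD hab => ?_⟩
  · exact hS a ha haD b hbD ((h a haD b hbD).2 hab)
  · exact hS a ha haD b hbD ((h a haD b hbD).1 hab)

lemma cluster_eq_explored (G : SimpleGraph (Fin n)) (v : Fin n) :
    cluster G v = explored G ∅ {v} := by
  apply subset_antisymm
  · rintro x ⟨p⟩
    refine Set.mem_sInter.2 fun S hS => ?_
    have hv : v ∈ S := hS.1 (by simp)
    obtain ⟨-, hS⟩ := hS
    induction p with
    | nil => exact hv
    | cons h _ ih => exact ih (hS _ hv (Set.notMem_empty _) _ (Set.notMem_empty _) h)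
  · refine Set.sInter_subset_of_mem ⟨?_, fun a ha _ b _ hab => ?_⟩
    · rintro x (hx | rfl)
      · exact absurd hx (Set.notMem_empty _)
      · exact SimpleGraph.Reachable.refl _
    · exact SimpleGraph.Reachable.trans ha hab.reachable

/-! ### Independence of the edges of the random graph -/

/-- The slot of the edge between two distinct vertices. -/
def edgeSlot {i j : Fin n} (h : i ≠ j) : EdgeSlot n := ⟨(min i j, max i j), min_lt_max.2 h⟩

lemma graphOfOccupied_adj {ω : EdgeSlot n → Prop} {i j : Fin n} :
    (graphOfOccupied ω).Adj i j ↔ ∃ h : i ≠ j, ω (edgeSlot h) := by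
  rw [graphOfOccupied, SimpleGraph.fromRel_adj]
  rcases lt_trichotomy i j with h | rfl | h
  · simp [h, h.ne, h.not_gt, edgeSlot, min_eq_left h.le, max_eq_right h.le]
  · simp
  · simp [h, h.ne', h.not_gt, edgeSlot, min_eq_right h.le, max_eq_left h.le]

/-- The law of the occupied edges of the graph. -/
noncomputable def occupiedLaw (w : Fin n → ℝ≥0) : Measure (EdgeSlot n → Prop) :=
  Measure.pi fun e : EdgeSlot n => bernoulliMeasure True False (edgeProb w e.1.1 e.1.2)

instance (w : Fin n → ℝ≥0) : IsProbabilityMeasure (occupiedLaw w) := by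
  unfold occupiedLaw
  infer_instance

/-- The configuration in which only the edges in `S` are kept. -/
def keepEdges (S : Set (EdgeSlot n)) (ω : EdgeSlot n → Prop) (e : EdgeSlot n) : Prop :=
  e ∈ S ∧ ω e

lemma indepFun_keepEdges (w : Fin n → ℝ≥0) (S : Set (EdgeSlot n)) :
    IndepFun (keepEdges S) (keepEdges Sᶜ) (occupiedLaw w) := by
  classical
  have hind : iIndepFun (fun (e : EdgeSlot n) (ω : EdgeSlot n → Prop) => ω e) (occupiedLaw w) :=
    iIndepFun_pi (X := fun _ => id) fun _ => aemeasurable_id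
  have h := hind.indepFun_finset S.toFinset Sᶜ.toFinset
    (Set.disjoint_toFinset.2 disjoint_compl_right) fun e => measurable_pi_apply e
  have h' := h.comp (φ := fun x e => ∃ he : e ∈ S.toFinset, x ⟨e, he⟩)
    (ψ := fun x e => ∃ he : e ∈ Sᶜ.toFinset, x ⟨e, he⟩) Measurable.of_discrete
    Measurable.of_discrete
  convert h' using 1
  · funext ω e
    simp [keepEdges]
  · funext ω e
    simp [keepEdges]

/-- The expectation of `φ` of the set of vertices found by exploring the graph. -/
noncomputable def exploredExpectation (w : Fin n → ℝ≥0) (φ : Set (Fin n) → ℝ≥0∞)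
    (D R : Set (Fin n)) : ℝ≥0∞ :=
  ∫⁻ ω, φ (explored (graphOfOccupied ω) D R) ∂occupiedLaw w

/-- The neighbours of `m` are independent of the graph on the other vertices. -/
lemma exploredExpectation_insert_of_notMem (w : Fin n → ℝ≥0) (φ : Set (Fin n) → ℝ≥0∞)
    {D : Set (Fin n)} (R : Set (Fin n)) {m : Fin n} (hm : m ∉ D) :
    exploredExpectation w φ D (insert m R) =
      ∫⁻ ω, exploredExpectation w φ (insert m D)
        (insert m R ∪ (graphOfOccupied ω).neighborSet m) ∂occupiedLaw w := by
  -- The slots at `m` determine its neighbours; once `m` has joined `D`, the exploration uses only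
  -- the other slots.
  let S : Set (EdgeSlot n) := {e | e.1.1 = m ∨ e.1.2 = m}
  have hS : ∀ ω, (graphOfOccupied (keepEdges S ω)).neighborSet m =
      (graphOfOccupied ω).neighborSet m := fun ω => by
    ext j
    simp only [SimpleGraph.mem_neighborSet, graphOfOccupied_adj]
    refine exists_congr fun h => and_iff_right ?_
    rcases le_total m j with hj | hj
    · exact Or.inl (min_eq_left hj)
    · exact Or.inr (max_eq_left hj)
  have hSc : ∀ ω R', explored (graphOfOccupied (keepEdges Sᶜ ω)) (insert m D) R' =
      explored (graphOfOccupied ω) (insert m D) R' := fun ω R' => by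
    refine explored_congr _ fun a ha b hb => ?_
    simp only [Set.mem_insert_iff, not_or] at ha hb
    simp only [graphOfOccupied_adj]
    refine exists_congr fun h => and_iff_right ?_
    rintro (h' | h')
    · rcases min_choice a b with hab | hab
      exacts [ha.1 (hab.symm.trans h'), hb.1 (hab.symm.trans h')]
    · rcases max_choice a b with hab | hab
      exacts [ha.1 (hab.symm.trans h'), hb.1 (hab.symm.trans h')]
  let f : (EdgeSlot n → Prop) × (EdgeSlot n → Prop) → ℝ≥0∞ := fun q =>
    φ (explored (graphOfOccupied q.2) (insert m D)
      (insert m R ∪ (graphOfOccupied q.1).neighborSet m))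
  have hmeas : ∀ T : Set (EdgeSlot n), Measurable (keepEdges T) := fun T => Measurable.of_discrete
  have hind := (indepFun_iff_map_prod_eq_prod_map_map (hmeas S).aemeasurable
    (hmeas Sᶜ).aemeasurable).1 (indepFun_keepEdges w S)
  calc exploredExpectation w φ D (insert m R)
      = ∫⁻ ω, f (keepEdges S ω, keepEdges Sᶜ ω) ∂occupiedLaw w := by
        simp only [exploredExpectation, f, hS, hSc, explored_insert_of_notMem _ R hm]
    _ = ∫⁻ q, f q ∂(occupiedLaw w).map fun ω => (keepEdges S ω, keepEdges Sᶜ ω) :=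
        (lintegral_map Measurable.of_discrete Measurable.of_discrete).symm
    _ = _ := by
        rw [hind, lintegral_prod _ Measurable.of_discrete.aemeasurable,
          lintegral_map Measurable.of_discrete (hmeas S)]
        refine lintegral_congr fun ω => ?_
        rw [lintegral_map Measurable.of_discrete (hmeas Sᶜ)]
        simp only [exploredExpectation, f, hS, hSc]

lemma edgeSlot_injective {m : Fin n} {p : Fin n → Prop} (hp : ∀ j, p j → m ≠ j) :
    Function.Injective fun j : {j // p j} => edgeSlot (hp j j.2) := by
  rintro ⟨i, hi⟩ ⟨j, hj⟩ h
  have hi' := hp i hi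
  have hj' := hp j hj
  simp only [edgeSlot, Subtype.mk.injEq, Prod.mk.injEq] at h ⊢
  grind

lemma bernoulliMeasure_edgeProb_edgeSlot (w : Fin n → ℝ≥0) {i j : Fin n} (h : i ≠ j) :
    bernoulliMeasure True False (edgeProb w (edgeSlot h).1.1 (edgeSlot h).1.2) {False} =
      ENNReal.ofReal (Real.exp (-((w i * w j / totalWeight w : ℝ≥0) : ℝ))) := by
  have hsymm : edgeProb w (edgeSlot h).1.1 (edgeSlot h).1.2 = edgeProb w i j := by
    rcases le_total i j with hij | hij
    · simp [edgeSlot, min_eq_left hij, max_eq_right hij]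
    · simp [edgeSlot, min_eq_right hij, max_eq_left hij, edgeProb, mul_comm]
  classical
  rw [hsymm, bernoulliMeasure_apply _ MeasurableSet.of_discrete, if_neg (by simp), if_pos (Set.mem_singleton _),
    ENNReal.ofReal]
  congr 1
  ext
  rw [Real.coe_toNNReal _ (Real.exp_pos _).le]
  simp [edgeProb]

/-- The event says that every slot from `m` to the complement of `B` is vacant. As `m ∈ B`, these
are genuine, distinct slots. -/
lemma occupiedLaw_neighborSet_subset (w : Fin n → ℝ≥0) {m : Fin n} {B : Set (Fin n)}
    [DecidablePred (· ∈ B)] (hm : m ∈ B) :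
    occupiedLaw w {ω | (graphOfOccupied ω).neighborSet m ⊆ B} =
      ENNReal.ofReal
        (Real.exp (-∑ j with j ∉ B, ((w m * w j / totalWeight w : ℝ≥0) : ℝ))) := by
  classical
  have hne : ∀ j, j ∉ B → m ≠ j := fun j hj h => hj (h ▸ hm)
  let s : Finset (EdgeSlot n) :=
    Finset.univ.image fun j : {j // j ∉ B} => edgeSlot (hne j j.2)
  have hset : {ω : EdgeSlot n → Prop | (graphOfOccupied ω).neighborSet m ⊆ B} =
      (s : Set (EdgeSlot n)).pi fun _ => {False} := by
    ext ω
    simp only [Set.mem_ofPred_eq, Set.mem_pi, s, Finset.coe_image, Finset.coe_univ, Set.image_univ,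
      Set.forall_mem_range, Set.mem_singleton_iff, Subtype.forall, Set.subset_def,
      SimpleGraph.mem_neighborSet, graphOfOccupied_adj]
    refine forall_congr' fun j => ⟨fun h hj => ?_, fun h hω => ?_⟩
    · exact eq_false fun hω => hj (h ⟨hne j hj, hω⟩)
    · by_contra hj
      obtain ⟨hmj, hω⟩ := hω
      exact (h hj).mp hω
  rw [hset, occupiedLaw, ← Measure.infinitePi_eq_pi,
    Measure.infinitePi_pi _ fun _ _ => MeasurableSet.of_discrete,
    Finset.prod_image fun _ _ _ _ h => edgeSlot_injective hne h]
  simp only [bernoulliMeasure_edgeProb_edgeSlot]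
  rw [← ENNReal.ofReal_prod_of_nonneg fun _ _ => (Real.exp_pos _).le, ← Real.exp_sum,
    Finset.sum_neg_distrib]
  congr 3
  rw [Finset.sum_subtype (p := fun j => j ∉ B) _ (by simp)]

/-! ### Random sets of marks and the Poisson identity -/

/-- The expectation of `ψ` after the mark of one more individual has been added to `R`. -/
noncomputable def addMark (w : Fin n → ℝ≥0) (ψ : Set (Fin n) → ℝ≥0∞) (R : Set (Fin n)) : ℝ≥0∞ :=
  ∫⁻ m, ψ (insert m R) ∂markLaw w

/-- The law of the set that consists of `R` and of the marks of `k` further individuals. -/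
noncomputable def marksLaw (w : Fin n → ℝ≥0) : ℕ → Set (Fin n) → Measure (Set (Fin n))
  | 0, R => Measure.dirac R
  | k + 1, R => (markLaw w).bind fun m => marksLaw w k (insert m R)

lemma lintegral_marksLaw (w : Fin n → ℝ≥0) (ψ : Set (Fin n) → ℝ≥0∞) (k : ℕ) (R : Set (Fin n)) :
    ∫⁻ A, ψ A ∂marksLaw w k R = (addMark w)^[k] ψ R := by
  induction k generalizing R with
  | zero => simp [marksLaw]
  | succ k ih =>
    rw [marksLaw, Measure.lintegral_bind Measurable.of_discrete.aemeasurable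
      Measurable.of_discrete.aemeasurable, Function.iterate_succ_apply', addMark]
    simp only [ih]

lemma addMark_iterate_insert (w : Fin n → ℝ≥0) (ψ : Set (Fin n) → ℝ≥0∞) (k : ℕ) (m : Fin n)
    (R : Set (Fin n)) :
    (addMark w)^[k] (fun A => ψ (insert m A)) R = (addMark w)^[k] ψ (insert m R) := by
  induction k generalizing R with
  | zero => rfl
  | succ k ih =>
    simp only [Function.iterate_succ_apply', addMark]
    refine lintegral_congr fun a => ?_
    rw [ih, Set.insert_comm]

lemma addMark_iterate_lintegral (w : Fin n → ℝ≥0) [IsProbabilityMeasure (markLaw w)]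
    (ν : Measure ℕ) [SFinite ν] (ψ : ℕ → Set (Fin n) → ℝ≥0∞) (k : ℕ) (R : Set (Fin n)) :
    (addMark w)^[k] (fun A => ∫⁻ x, ψ x A ∂ν) R = ∫⁻ x, (addMark w)^[k] (ψ x) R ∂ν := by
  induction k generalizing R with
  | zero => rfl
  | succ k ih =>
    simp only [Function.iterate_succ_apply', addMark]
    simp only [ih]
    exact lintegral_lintegral_swap Measurable.of_discrete.aemeasurable

/-- The indicator of the subsets of `B` is an eigenfunction of `addMark w` with eigenvalue `markLaw
w B`, so iterates become powers. -/
lemma addMark_indicator_Iic (w : Fin n → ℝ≥0) (B R : Set (Fin n)) :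
    addMark w ((Set.Iic B).indicator 1) R = markLaw w B * (Set.Iic B).indicator 1 R := by
  classical
  have : ∀ m, (Set.Iic B).indicator (1 : Set (Fin n) → ℝ≥0∞) (insert m R) =
      (Set.Iic B).indicator 1 R * B.indicator 1 m := fun m => by
    simp only [Set.indicator_apply, Set.mem_Iic, Set.insert_subset_iff,
      Pi.one_apply]
    split_ifs <;> simp_all
  simp only [addMark, this]
  rw [lintegral_const_mul _ Measurable.of_discrete,
    lintegral_indicator_one MeasurableSet.of_discrete, mul_comm]

lemma addMark_iterate_indicator_Iic (w : Fin n → ℝ≥0) (B R : Set (Fin n)) (k : ℕ) :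
    (addMark w)^[k] ((Set.Iic B).indicator 1) R =
      markLaw w B ^ k * (Set.Iic B).indicator 1 R := by
  induction k generalizing R with
  | zero => simp
  | succ k ih =>
    have h : (addMark w)^[k] ((Set.Iic B).indicator 1) =
        fun R => markLaw w B ^ k * (Set.Iic B).indicator 1 R := funext ih
    rw [Function.iterate_succ_apply', h, addMark, lintegral_const_mul _ Measurable.of_discrete]
    change _ * addMark w ((Set.Iic B).indicator 1) R = _
    rw [addMark_indicator_Iic, pow_succ, mul_assoc]

/-- The probability generating function of the Poisson distribution. -/
lemma lintegral_pow_poissonMeasure (r q : ℝ≥0) :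
    ∫⁻ x, (q : ℝ≥0∞) ^ x ∂poissonMeasure r = ENNReal.ofReal (Real.exp (r * q - r)) := by
  have h : ∀ x : ℕ, (q : ℝ≥0∞) ^ x * poissonMeasure r {x} =
      ENNReal.ofReal (Real.exp (r * q - r)) * poissonMeasure (r * q) {x} := fun x => by
    rw [poissonMeasure_singleton, poissonMeasure_singleton, ← ENNReal.ofReal_coe_nnreal,
      ← ENNReal.ofReal_pow q.coe_nonneg, ← ENNReal.ofReal_mul (pow_nonneg q.coe_nonneg x),
      ← ENNReal.ofReal_mul (Real.exp_pos _).le]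
    congr 1
    -- Tilting by `q ^ x` turns mean `r` into mean `r * q`, up to this normalising factor.
    have : Real.exp (-r) = Real.exp (r * q - r) * Real.exp (-(r * q : ℝ≥0)) := by
      rw [← Real.exp_add]
      push_cast
      ring_nf
    rw [this]
    push_cast
    ring
  rw [lintegral_countable']
  simp only [h]
  rw [ENNReal.tsum_mul_left]
  have h1 : ∑' x, poissonMeasure (r * q) {x} = 1 := by
    have := lintegral_countable' (μ := poissonMeasure (r * q)) fun _ => 1
    simpa using this.symm
  rw [h1, mul_one]

/-- Induction on `A` along inclusion: the mass of `{A}` is that of `Set.Iic A` minus that of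
`Set.Iio A`. -/
lemma ext_of_Iic_set {α : Type*} [Finite α] [MeasurableSpace (Set α)]
    [MeasurableSingletonClass (Set α)] {μ ν : Measure (Set α)} [IsFiniteMeasure μ]
    (h : ∀ B, μ (Set.Iic B) = ν (Set.Iic B)) : μ = ν := by
  refine Measure.ext_of_singleton fun A => ?_
  induction A using WellFoundedLT.induction with
  | _ A ih =>
    have hdisj : Disjoint (Set.Iio A) {A} := by simp
    have hIio : μ (Set.Iio A) = ν (Set.Iio A) := by
      have hc : (Set.Iio A).Countable := Set.to_countable _
      have hd : (Set.Iio A).PairwiseDisjoint fun B => ({B} : Set (Set α)) :=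
        fun _ _ _ _ h => Set.disjoint_singleton.2 h
      rw [← Set.biUnion_of_singleton (Set.Iio A),
        measure_biUnion hc hd fun _ _ => measurableSet_singleton _,
        measure_biUnion hc hd fun _ _ => measurableSet_singleton _]
      exact tsum_congr fun B => ih B B.2
    have hA := h A
    rw [← Set.Iio_union_right, measure_union hdisj (measurableSet_singleton _),
      measure_union hdisj (measurableSet_singleton _), ← hIio] at hA
    exact (ENNReal.add_right_inj (measure_ne_top μ _)).1 hA

lemma markLaw_apply (w : Fin n → ℝ≥0) (B : Set (Fin n)) [DecidablePred (· ∈ B)] :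
    markLaw w B = ((∑ j with j ∈ B, w j / totalWeight w : ℝ≥0) : ℝ≥0∞) := by
  rw [Finset.sum_filter, ENNReal.ofNNReal_finsetSum]
  simp [markLaw, Set.indicator_apply, apply_ite ((↑) : ℝ≥0 → ℝ≥0∞)]

/-- A Poisson number of individuals with mean `w m` and the neighbours of `m` in the graph
contribute the same marks, in distribution. -/
lemma lintegral_addMark_iterate_poissonMeasure {w : Fin n → ℝ≥0} (hw : 0 < totalWeight w)
    (ψ : Set (Fin n) → ℝ≥0∞) (m : Fin n) (R : Set (Fin n)) :
    ∫⁻ x, (addMark w)^[x] ψ (insert m R) ∂poissonMeasure (w m) =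
      ∫⁻ ω, ψ (insert m R ∪ (graphOfOccupied ω).neighborSet m) ∂occupiedLaw w := by
  classical
  let N : (EdgeSlot n → Prop) → Set (Fin n) := fun ω =>
    insert m R ∪ (graphOfOccupied ω).neighborSet m
  have hN : Measurable N := Measurable.of_discrete
  have hlaw : (occupiedLaw w).map N =
      (poissonMeasure (w m)).bind fun x => marksLaw w x (insert m R) := by
    have : IsProbabilityMeasure ((occupiedLaw w).map N) :=
      Measure.isProbabilityMeasure_map hN.aemeasurable
    refine ext_of_Iic_set fun B => ?_
    rw [← lintegral_indicator_one (μ := (poissonMeasure (w m)).bind _) MeasurableSet.of_discrete,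
      Measure.lintegral_bind Measurable.of_discrete.aemeasurable
        Measurable.of_discrete.aemeasurable, Measure.map_apply hN MeasurableSet.of_discrete]
    simp only [lintegral_marksLaw, addMark_iterate_indicator_Iic]
    -- Otherwise both sides vanish. If it holds, both equal `exp (-w m * (1 - q))` with `q` the mass
    -- of `B` under `markLaw w`.
    by_cases hB : insert m R ⊆ B
    · have hset : N ⁻¹' Set.Iic B = {ω | (graphOfOccupied ω).neighborSet m ⊆ B} := by
        ext ω
        simp [N, hB, Set.union_subset_iff]
      have hsum : (∑ j with j ∈ B, w j / totalWeight w) +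
          (∑ j with j ∉ B, w j / totalWeight w) = 1 := by
        rw [Finset.sum_filter_add_sum_filter_not, ← Finset.sum_div, ← totalWeight,
          div_self hw.ne']
      have hsum' : ((∑ j with j ∈ B, w j / totalWeight w : ℝ≥0) : ℝ) +
          ((∑ j with j ∉ B, w j / totalWeight w : ℝ≥0) : ℝ) = 1 := by exact_mod_cast hsum
      rw [Set.indicator_of_mem (by exact hB), markLaw_apply, hset,
        occupiedLaw_neighborSet_subset w (hB (Set.mem_insert m R))]
      simp only [Pi.one_apply, mul_one]
      rw [lintegral_pow_poissonMeasure]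
      congr 2
      have hmul : ∑ j with j ∉ B, ((w m * w j / totalWeight w : ℝ≥0) : ℝ) =
          w m * ((∑ j with j ∉ B, w j / totalWeight w : ℝ≥0) : ℝ) := by
        push_cast
        rw [Finset.mul_sum]
        simp only [mul_div_assoc]
      rw [hmul]
      linear_combination (-(w m : ℝ)) * hsum'
    · have hset : N ⁻¹' Set.Iic B = ∅ := by
        ext ω
        simp only [N, Set.mem_preimage, Set.mem_Iic, Set.mem_empty_iff_false, iff_false]
        exact fun h => hB (Set.subset_union_left.trans h)
      rw [Set.indicator_of_notMem (by exact hB), hset]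
      simp
  rw [← lintegral_map (f := ψ) (g := N) Measurable.of_discrete hN, hlaw,
    Measure.lintegral_bind Measurable.of_discrete.aemeasurable Measurable.of_discrete.aemeasurable]
  simp only [lintegral_marksLaw]

/-! ### Comparison of the two explorations -/

lemma exploredExpectation_insert_of_mem (w : Fin n → ℝ≥0) (φ : Set (Fin n) → ℝ≥0∞)
    {D : Set (Fin n)} (R : Set (Fin n)) {m : Fin n} (hm : m ∈ D) :
    exploredExpectation w φ D (insert m R) = exploredExpectation w φ D R := by
  simp only [exploredExpectation, explored_insert_of_mem _ _ hm]

lemma exploredExpectation_empty (w : Fin n → ℝ≥0) (φ : Set (Fin n) → ℝ≥0∞) (D : Set (Fin n)) :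
    exploredExpectation w φ D ∅ = φ D := by
  simp [exploredExpectation, explored_empty]

/-- Instead of exploring a new vertex `m` of the graph, one may draw the marks of a Poisson number
of individuals. -/
lemma exploredExpectation_insert_eq_lintegral_poissonMeasure {w : Fin n → ℝ≥0}
    (hw : 0 < totalWeight w) (φ : Set (Fin n) → ℝ≥0∞) {D : Set (Fin n)} (R : Set (Fin n))
    {m : Fin n} (hm : m ∉ D) :
    exploredExpectation w φ D (insert m R) =
      ∫⁻ x, (addMark w)^[x] (exploredExpectation w φ (insert m D)) R ∂poissonMeasure (w m) := by
  rw [exploredExpectation_insert_of_notMem w φ R hm,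
    ← lintegral_addMark_iterate_poissonMeasure hw]
  refine lintegral_congr fun x => ?_
  -- The extra `m` moves into the integrand, where it is absorbed by `insert m D`.
  rw [← addMark_iterate_insert]
  simp only [exploredExpectation_insert_of_mem w φ _ (Set.mem_insert m D)]

/-- The exploration of the branching process from the state `(D, k)` finds the same set of marks,
in distribution, as the exploration of the graph from `k` vertices with independent marks. -/
lemma finalExpectation_eq_addMark_iterate {w : Fin n → ℝ≥0} (hw : 0 < totalWeight w)
    (φ : Set (Fin n) → ℝ≥0∞) (D : Set (Fin n)) (k : ℕ) :
    finalExpectation w φ (D, k) = (addMark w)^[k] (exploredExpectation w φ D) ∅ := by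
  have := isProbabilityMeasure_markLaw hw
  -- The order is lexicographic: larger `D` first, then smaller `k` for the same `D`.
  induction D using WellFoundedGT.induction generalizing k with
  | _ D ihD =>
    induction k with
    | zero => rw [finalExpectation_zero, Function.iterate_zero_apply, exploredExpectation_empty]
    | succ k ihk =>
      rw [finalExpectation_eq_lintegral, Function.iterate_succ_apply', addMark]
      refine lintegral_congr fun m => ?_
      rw [← addMark_iterate_insert]
      by_cases hm : m ∈ D
      · simp only [exploreStep, Nat.succ_ne_zero, if_false, hm, if_true, Set.insert_eq_of_mem,
          exploredExpectation_insert_of_mem w φ _ hm, Nat.add_sub_cancel, add_zero, ihk,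
          lintegral_const, measure_univ, mul_one]
      -- With `x` children there are `k + x` marks to draw; on the graph side, `x` of them replace
      -- the neighbours of `m`, and the Poisson integral commutes with the other `k` draws.
      · simp only [exploreStep, Nat.succ_ne_zero, if_false, hm, Nat.add_sub_cancel,
          ihD (insert m D) (Set.ssubset_insert hm),
          exploredExpectation_insert_eq_lintegral_poissonMeasure hw φ _ hm,
          addMark_iterate_lintegral, Function.iterate_add_apply]

/-- The cluster of a vertex and the exploration from that vertex. -/
lemma lintegral_cluster {w : Fin n → ℝ≥0} (hw : 0 < totalWeight w)
    (φ : Set (Fin n) → ℝ≥0∞) (v : Fin n) :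
    ∫⁻ ω, φ (cluster (graphOfOccupied ω) v) ∂occupiedLaw w =
      ∫⁻ x, finalExpectation w φ ({v}, x) ∂poissonMeasure (w v) := by
  have h := exploredExpectation_insert_eq_lintegral_poissonMeasure hw φ ∅ (Set.notMem_empty v)
  simp only [insert_empty_eq] at h
  simp only [cluster_eq_explored, finalExpectation_eq_addMark_iterate hw, ← h]
  rfl

/-- A graph is determined by its adjacency relation, so singletons are measurable, and there are
finitely many graphs. -/
instance : DiscreteMeasurableSpace (SimpleGraph (Fin n)) := by
  have : MeasurableSingletonClass (SimpleGraph (Fin n)) :=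
    ⟨fun G => ⟨{G.Adj}, measurableSet_singleton _, by
      ext H
      simp [SimpleGraph.adj_inj]⟩⟩
  infer_instance

end NorrosReittu

theorem proposition3p3 {n : ℕ} (w : Fin n → ℝ≥0) (hw : 0 < NorrosReittu.totalWeight w)
    {Ω : Type*} [MeasurableSpace Ω] (P : Measure Ω) [IsProbabilityMeasure P]
    (G : Ω → SimpleGraph (Fin n)) (V : Ω → Fin n)
    (hG : HasLaw G (NorrosReittu.graphLaw w) P)
    (hV : HasLaw V (uniformOn Set.univ) P)
    (hGV : IndepFun G V P)
    {Ω' : Type*} [MeasurableSpace Ω'] (Q : Measure Ω') [IsProbabilityMeasure Q]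
    (M : ℕ → Ω' → Fin n) (X : ℕ → Ω' → ℕ)
    (hMX : HasLaw (fun ω i => (M i ω, X i ω)) (NorrosReittu.branchingLaw w) Q) :
    IdentDistrib (fun ω => NorrosReittu.cluster (G ω) (V ω))
      (fun ω => NorrosReittu.exploredMarks (fun i => M i ω) (fun i => X i ω)) P Q := by
  open NorrosReittu in
  have hmark := isProbabilityMeasure_markLaw hw
  have hne : Nonempty (Fin n) := by
    by_contra h
    rw [not_nonempty_iff] at h
    simp [totalWeight] at hw
  have hφ : ∀ φ : Set (Fin n) → ℝ≥0∞, Measurable φ := fun φ => Measurable.of_discrete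
  have hc : Measurable fun q : SimpleGraph (Fin n) × Fin n => cluster q.1 q.2 :=
    Measurable.of_discrete
  have hgo : Measurable (graphOfOccupied (n := n)) := Measurable.of_discrete
  have hcm : AEMeasurable (fun ω => cluster (G ω) (V ω)) P :=
    hc.comp_aemeasurable (hG.aemeasurable.prodMk hV.aemeasurable)
  have hem : AEMeasurable (fun ω => exploredMarks (fun i => M i ω) (fun i => X i ω)) Q := by
    simp only [exploredMarks_eq_finalMarks]
    exact (measurable_finalMarks _).comp_aemeasurable hMX.aemeasurable
  refine ⟨hcm, hem, Measure.ext_of_lintegral _ fun φ _ => ?_⟩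
  rw [lintegral_map' (hφ φ).aemeasurable hcm, lintegral_map' (hφ φ).aemeasurable hem]
  simp only [exploredMarks_eq_finalMarks]
  have hP : ∫⁻ ω, φ (cluster (G ω) (V ω)) ∂P =
      ∫⁻ v, ∫⁻ ω, φ (cluster (graphOfOccupied ω) v) ∂occupiedLaw w ∂uniformOn Set.univ := by
    have hmap := (indepFun_iff_map_prod_eq_prod_map_map hG.aemeasurable hV.aemeasurable).1 hGV
    rw [hG.map_eq, hV.map_eq] at hmap
    rw [← lintegral_map' (f := fun q : SimpleGraph (Fin n) × Fin n => φ (cluster q.1 q.2))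
      (g := fun ω => (G ω, V ω)) ((hφ φ).comp hc).aemeasurable
      (hG.aemeasurable.prodMk hV.aemeasurable), hmap]
    have : IsProbabilityMeasure (graphLaw w) := by
      rw [← hG.map_eq]
      exact Measure.isProbabilityMeasure_map hG.aemeasurable
    -- Independence allows the graph to be integrated out first, for a fixed root `v`.
    refine (lintegral_prod_symm (fun q => φ (cluster q.1 q.2))
      ((hφ φ).comp hc).aemeasurable).trans ?_
    refine lintegral_congr fun v => ?_
    rw [graphLaw]
    exact lintegral_map ((hφ φ).comp (hc.comp measurable_prodMk_right)) hgo
  have hQ : ∫⁻ ω, φ (finalMarks (∅, 1) fun i => (M i ω, X i ω)) ∂Q =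
      ∫⁻ y, φ (finalMarks (∅, 1) y) ∂branchingLaw w := by
    rw [← hMX.map_eq]
    exact (lintegral_map' ((hφ φ).comp (measurable_finalMarks _)).aemeasurable
      hMX.aemeasurable).symm
  rw [hP, hQ, lintegral_branchingLaw]
  simp only [lintegral_cluster hw]
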